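/- For $n,m\in\mathbb N$ and $p\in[0,1]$ let $\mathcal G(n,m,p)$ be the random intersection graph with $n$ vertices and a set $\mathcal W$ of $m$ features: every vertex $v$ receives a random set $W_v\subseteq\mathcal W$ that contains each feature with probability $p$, independently over all vertices and features, and two distinct vertices $u,v$ are adjacent if and only if $W_u\cap W_v\neq\emptyset$. Let $\alpha>0$ be a constant and let $m=m(n)=n^{\alpha}$, rounded up or down to an integer if $n^\alpha$ is not one (that is, $m(n)$ is any integer with $|m(n)-n^{\alpha}|<1$). Let $\omega=\omega(n)$ be a sequence of real numbers such that, for all large $n$, the following number $p_1=p_1(n)$ is defined and lies in $[0,1]$: $$ p_1=\begin{cases}\dfrac{\ln n+\omega}{m}, & \alpha\le 1,\\[2mm] \sqrt{\dfrac{\ln n+\omega}{nm}}, & \alpha>1.\end{cases} $$ (i) If $\omega\to-\infty$ as $n\to\infty$, then with probability tending to $1$ as $n\to\infty$ the graph $\mathcal G(n,m,p_1)$ is disconnected. (ii) If $\omega\to\infty$ as $n\to\infty$, then with probability tending to $1$ as $n\to\infty$ the graph $\mathcal G(n,m,p_1)$ is connected. -/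

import Mathlib

open Filter Topology MeasureTheory ProbabilityTheory unitInterval

/-- The intersection graph of a family of feature sets `W v ⊆ {0, …, m - 1}`, one for each vertex
`v ∈ {0, …, n - 1}`: distinct vertices are adjacent iff their feature sets intersect. -/
def intersectionGraph {n m : ℕ} (W : Fin n → Set (Fin m)) : SimpleGraph (Fin n) where
  Adj u v := u ≠ v ∧ (W u ∩ W v).Nonempty
  symm := ⟨fun u v h => ⟨h.1.symm, by rw [Set.inter_comm]; exact h.2⟩⟩
  loopless := ⟨fun _ h => h.1 rfl⟩

/-- The law of the feature sets in `G(n, m, p)`: the sets `W v` are independent, and each `W v` is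
the random subset of the `m` features that contains every feature independently with
probability `p`. -/
noncomputable def featureLaw (n m : ℕ) (p : I) : Measure (Fin n → Set (Fin m)) :=
  Measure.pi fun _ : Fin n => setBernoulli (Set.univ : Set (Fin m)) p

/-- The probability that the random intersection graph `G(n, m, p)` has the property `A`. (The
sample space is finite and every subset of it is measurable, see
`measurableSet_featureEvent`.) -/
noncomputable def probRIG (n m : ℕ) (p : I) (A : SimpleGraph (Fin n) → Prop) : ℝ :=
  (featureLaw n m p).real {W | A (intersectionGraph W)}

/-- The value of `p₁` for `n` vertices, `m` features, and the value `w` of `ω`. -/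
noncomputable def thresholdP (α : ℝ) (n m : ℕ) (w : ℝ) : ℝ :=
  if α ≤ 1 then (Real.log n + w) / m else Real.sqrt ((Real.log n + w) / (n * m))

instance isProbabilityMeasure_featureLaw (n m : ℕ) (p : I) :
    IsProbabilityMeasure (featureLaw n m p) := by
  unfold featureLaw; infer_instance

theorem measurableSet_featureEvent {n m : ℕ} (S : Set (Fin n → Set (Fin m))) :
    MeasurableSet S :=
  S.toFinite.measurableSet

/-!
Each feature picks a random set of vertices, and these sets are independent of each other
(`map_featureColumns_featureLaw`). Hence an event that demands the same of every feature has a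
probability of the form `c ^ m` (`featureLaw_real_forall_featureColumns_mem`). This covers the
event that a vertex is isolated, that two vertices are, and that no edge crosses a given cut.

Below the threshold there is an isolated vertex. The expected number of isolated vertices tends to
infinity, and for two vertices the isolation events are asymptotically uncorrelated because
`m p ^ 2 → 0`; the second moment method (`probRIG_connected_le`) does the rest, for all `α` alike.

Above the threshold the probability of a cut without edges is at most the union bound `cutSum`,
which decreases in `p`, so that `p` may be replaced by a smaller convenient value without a
coupling. The term for the sets of size `k` is compared with the `k`-th power of the term for
isolated vertices (`cutSum_term_le_of_small`) or, for large `k`, estimated crudely; so the sum tends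
to `0` as soon as the expected number of isolated vertices does (`tendsto_cutSum`). This settles
`α ≥ 1`. For `α < 1` the union bound over vertex sets fails, as there are far more of them than the
few features can separate. There the roles of vertices and features are exchanged: the graph in
which two features are adjacent if they share a vertex is connected by the same bound, far above
its threshold, and it remains that no vertex is without features, which has probability at least
`1 - n (1 - p) ^ m ≥ 1 - exp (-ω)` (`one_sub_dual_cutSum_le_probRIG_connected`).
-/

/-! ### The random subset and the exchange of vertices and features -/

theorem setBernoulli_univ_apply_singleton {ι : Type*} [Fintype ι] [DecidableEq ι] (p : I)
    (s : Set ι) [DecidablePred (· ∈ s)] :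
    setBernoulli (Set.univ : Set ι) p {s} =
      ∏ i, if i ∈ s then (toNNReal p : ENNReal) else (toNNReal (σ p) : ENNReal) := by
  rw [setBernoulli_singleton p (Set.subset_univ s) Set.finite_univ, Finset.prod_ite]
  simp only [Finset.prod_const]
  congr 2
  · rw [Set.ncard_eq_toFinset_card' s]; congr 1; ext; simp
  · rw [Set.ncard_eq_toFinset_card']; congr 1; ext; simp

theorem setBernoulli_univ_real_disjoint {ι : Type*} [Fintype ι] (p : I) (A : Finset ι) :
    (setBernoulli (Set.univ : Set ι) p).real {S | Disjoint S (A : Set ι)} =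
      (1 - p : ℝ) ^ A.card := by
  classical
  have key : setBernoulli (Set.univ : Set ι) p {S | Disjoint S (A : Set ι)} =
      (toNNReal (σ p) : ENNReal) ^ A.card := by
    rw [setBernoulli_apply', Measure.infinitePi_eq_pi]
    have : (fun p : ι → Prop ↦ {i | p i}) ⁻¹' {S | Disjoint S (A : Set ι)} =
        Set.pi Set.univ (fun i => if i ∈ A then {False} else Set.univ) := by
      ext f
      simp only [Set.mem_preimage, Set.mem_ofPred_eq, Set.disjoint_left, Set.mem_pi,
        Set.mem_univ, true_imp_iff, Finset.mem_coe]
      refine forall_congr' fun i => ?_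
      by_cases hi : i ∈ A <;> simp [hi]
    rw [this, Measure.pi_pi]
    have h : ∀ i : ι, ((toNNReal p • Measure.dirac (i ∈ (Set.univ : Set ι)) +
        toNNReal (σ p) • Measure.dirac False : Measure Prop)
          (if i ∈ A then {False} else Set.univ)) =
          if i ∈ A then (toNNReal (σ p) : ENNReal) else 1 := by
      intro i
      by_cases hi : i ∈ A
      · simp [hi]
      · simp [hi]
    simp_rw [h]
    simp
  rw [measureReal_def, key]
  simp

theorem featureLaw_singleton {n m : ℕ} (p : I) (W : Fin n → Set (Fin m))
    [∀ v, DecidablePred (· ∈ W v)] :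
    featureLaw n m p {W} = ∏ v, ∏ f,
      if f ∈ W v then (toNNReal p : ENNReal) else (toNNReal (σ p) : ENNReal) := by
  rw [featureLaw, ← Set.univ_pi_singleton, Measure.pi_pi]
  simp_rw [setBernoulli_univ_apply_singleton]

/-- For a family `W` of feature sets, `featureColumns W f` is the set of the vertices that have
the feature `f`. -/
def featureColumns {n m : ℕ} (W : Fin n → Set (Fin m)) (f : Fin m) : Set (Fin n) :=
  {v | f ∈ W v}

/-- The model is symmetric under the exchange of vertices and features: both are the two sides of
a random bipartite graph in which every edge is present with probability `p`. -/
theorem map_featureColumns_featureLaw (n m : ℕ) (p : I) :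
    (featureLaw n m p).map featureColumns = featureLaw m n p := by
  classical
  refine Measure.ext_of_singleton fun V => ?_
  have hpre : (featureColumns : (Fin n → Set (Fin m)) → _) ⁻¹' {V} = {featureColumns V} := by
    ext W
    simp only [Set.mem_preimage, Set.mem_singleton_iff]
    constructor
    · rintro rfl; rfl
    · rintro rfl; rfl
  rw [Measure.map_apply (fun S _ => measurableSet_featureEvent _) (measurableSet_featureEvent _),
    hpre, featureLaw_singleton, featureLaw_singleton, Finset.prod_comm]
  rfl

theorem featureLaw_real_featureColumns {n m : ℕ} (p : I) (S : Set (Fin m → Set (Fin n))) :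
    (featureLaw n m p).real {W | featureColumns W ∈ S} = (featureLaw m n p).real S := by
  rw [← map_featureColumns_featureLaw n m p, map_measureReal_apply
    (fun S _ => measurableSet_featureEvent _) (measurableSet_featureEvent _)]
  rfl

theorem featureLaw_real_forall_mem {n m : ℕ} (p : I) (C : Fin n → Set (Set (Fin m))) :
    (featureLaw n m p).real {W | ∀ v, W v ∈ C v} =
      ∏ v, (setBernoulli (Set.univ : Set (Fin m)) p).real (C v) := by
  have : {W : Fin n → Set (Fin m) | ∀ v, W v ∈ C v} = Set.pi Set.univ C := by
    ext; simp
  rw [this, measureReal_def, featureLaw, Measure.pi_pi, ENNReal.toReal_prod]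
  rfl

/-- An event that asks every feature for the same property of the set of vertices that have it. -/
theorem featureLaw_real_forall_featureColumns_mem {n m : ℕ} (p : I) (C : Set (Set (Fin n))) :
    (featureLaw n m p).real {W | ∀ f, featureColumns W f ∈ C} =
      (setBernoulli (Set.univ : Set (Fin n)) p).real C ^ m := by
  have h := featureLaw_real_featureColumns (n := n) (m := m) p {V | ∀ f, V f ∈ C}
  have h2 := featureLaw_real_forall_mem (n := m) (m := n) p (fun _ => C)
  simp only [Finset.prod_const, Finset.card_univ, Fintype.card_fin] at h2
  rw [← h2, ← h]
  rfl

/-! ### Cuts -/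

/-- A union bound for the probability that some cut of `G(n, m, p)` has no edge across it: the
term for `k` accounts for the vertex sets of size `k`. -/
noncomputable def cutSum (n m : ℕ) (p : ℝ) : ℝ :=
  ∑ k ∈ Finset.Icc 1 (n / 2), (n.choose k : ℝ) *
    Real.exp (-(m * ((1 - (1 - p) ^ k) * (1 - (1 - p) ^ (n - k)))))

theorem cutSum_nonneg (n m : ℕ) (p : ℝ) : 0 ≤ cutSum n m p :=
  Finset.sum_nonneg fun _ _ => by positivity

theorem cutSum_anti {n m : ℕ} {p q : ℝ} (hq : 0 ≤ q) (hqp : q ≤ p) (hp : p ≤ 1) :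
    cutSum n m p ≤ cutSum n m q := by
  have h1 : ∀ k : ℕ, (1 - p) ^ k ≤ (1 - q) ^ k := fun k =>
    pow_le_pow_left₀ (by linarith) (by linarith) k
  have h2 : ∀ k : ℕ, (1 - q) ^ k ≤ 1 := fun k => pow_le_one₀ (by linarith) (by linarith)
  refine Finset.sum_le_sum fun k _ => ?_
  have := h1 k
  have := h1 (n - k)
  have := h2 k
  have := h2 (n - k)
  gcongr
  · linarith

theorem exists_cut_of_not_preconnected {V : Type*} [Fintype V] [DecidableEq V]
    {G : SimpleGraph V} (h : ¬ G.Preconnected) :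
    ∃ A : Finset V, 1 ≤ A.card ∧ A.card ≤ Fintype.card V / 2 ∧
      ∀ a ∈ A, ∀ b ∉ A, ¬ G.Adj a b := by
  classical
  simp only [SimpleGraph.Preconnected, not_forall] at h
  obtain ⟨u, v, huv⟩ := h
  let B : Finset V := Finset.univ.filter fun w => G.Reachable u w
  have hB : ∀ a ∈ B, ∀ b ∉ B, ¬ G.Adj a b := by
    intro a ha b hb hab
    simp only [B, Finset.mem_filter, Finset.mem_univ, true_and] at ha hb
    exact hb (ha.trans hab.reachable)
  have hu : u ∈ B := by simp [B]
  have hv : v ∈ Bᶜ := by simp [B, huv]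
  have hc := Finset.card_compl_add_card B
  have h1 : 1 ≤ B.card := Finset.card_pos.2 ⟨u, hu⟩
  have h2 : 1 ≤ Bᶜ.card := Finset.card_pos.2 ⟨v, hv⟩
  rcases le_total B.card Bᶜ.card with h | h
  · exact ⟨B, h1, by omega, hB⟩
  · refine ⟨Bᶜ, h2, by omega, fun a ha b hb hab => ?_⟩
    exact hB b (by simpa using hb) a (by simpa using ha) hab.symm

/-- The probability that a random subset lies entirely on one side of the cut `(A, Aᶜ)`. -/
theorem setBernoulli_univ_real_not_split {n : ℕ} (p : I) (A : Finset (Fin n)) :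
    (setBernoulli (Set.univ : Set (Fin n)) p).real
        {S | Disjoint S (A : Set (Fin n)) ∨ Disjoint S ((Aᶜ : Finset (Fin n)) : Set (Fin n))} =
      1 - (1 - (1 - p : ℝ) ^ A.card) * (1 - (1 - p : ℝ) ^ (n - A.card)) := by
  have h := measureReal_union_add_inter (μ := setBernoulli (Set.univ : Set (Fin n)) p)
    (s := {S | Disjoint S (A : Set (Fin n))})
    (t := {S | Disjoint S ((Aᶜ : Finset (Fin n)) : Set (Fin n))})
    (Set.toFinite _).measurableSet
  have hi : {S : Set (Fin n) | Disjoint S (A : Set (Fin n))} ∩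
      {S | Disjoint S ((Aᶜ : Finset (Fin n)) : Set (Fin n))} =
      {S | Disjoint S ((Finset.univ : Finset (Fin n)) : Set (Fin n))} := by
    ext S
    simp only [Set.mem_inter_iff, Set.mem_ofPred_eq, ← Set.disjoint_union_right]
    simp
  rw [hi, setBernoulli_univ_real_disjoint, setBernoulli_univ_real_disjoint,
    setBernoulli_univ_real_disjoint, Finset.card_compl, Finset.card_univ, Fintype.card_fin] at h
  have hle : A.card ≤ n := by simpa using Finset.card_le_univ A
  have hpow : (1 - p : ℝ) ^ n = (1 - p : ℝ) ^ A.card * (1 - p : ℝ) ^ (n - A.card) := by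
    rw [← pow_add, Nat.add_sub_cancel' hle]
  rw [hpow] at h
  rw [Set.ofPred_or]
  linarith

theorem featureLaw_real_not_preconnected_le (n m : ℕ) (p : I) :
    (featureLaw n m p).real {W | ¬ (intersectionGraph W).Preconnected} ≤ cutSum n m p := by
  classical
  set C : Finset (Fin n) → Set (Set (Fin n)) := fun A =>
    {S | Disjoint S (A : Set (Fin n)) ∨ Disjoint S ((Aᶜ : Finset (Fin n)) : Set (Fin n))}
  set T : Finset (Finset (Fin n)) :=
    (Finset.Icc 1 (n / 2)).biUnion fun k => Finset.powersetCard k Finset.univ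
  have hsub : {W : Fin n → Set (Fin m) | ¬ (intersectionGraph W).Preconnected} ⊆
      ⋃ A ∈ T, {W | ∀ f, featureColumns W f ∈ C A} := by
    intro W hW
    obtain ⟨A, h1, h2, hA⟩ := exists_cut_of_not_preconnected hW
    simp only [Set.mem_iUnion]
    refine ⟨A, ?_, fun f => ?_⟩
    · simp only [T, Finset.mem_biUnion, Finset.mem_Icc, Finset.mem_powersetCard]
      exact ⟨A.card, ⟨h1, by simpa using h2⟩, Finset.subset_univ _, rfl⟩
    · by_contra hcon
      simp only [C, Set.mem_ofPred_eq, not_or, Set.not_disjoint_iff] at hcon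
      obtain ⟨⟨a, ha, haA⟩, b, hb, hbA⟩ := hcon
      have hbA' : b ∉ A := by simpa using hbA
      have haA' : a ∈ A := by simpa using haA
      exact hA a haA' b hbA' ⟨fun h => hbA' (h ▸ haA'), f, ha, hb⟩
  refine (measureReal_mono hsub (measure_ne_top _ _)).trans
    ((measureReal_biUnion_finset_le _ _).trans ?_)
  rw [Finset.sum_biUnion]
  · refine Finset.sum_le_sum fun k _ => ?_
    have hterm : ∀ A ∈ Finset.powersetCard k (Finset.univ : Finset (Fin n)),
        (featureLaw n m p).real {W | ∀ f, featureColumns W f ∈ C A} ≤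
          Real.exp (-(m * ((1 - (1 - p : ℝ) ^ k) * (1 - (1 - p : ℝ) ^ (n - k))))) := by
      intro A hA
      obtain rfl := (Finset.mem_powersetCard.1 hA).2
      rw [featureLaw_real_forall_featureColumns_mem, ← mul_neg, Real.exp_nat_mul]
      refine pow_le_pow_left₀ measureReal_nonneg ?_ m
      rw [setBernoulli_univ_real_not_split]
      exact Real.one_sub_le_exp_neg _
    refine (Finset.sum_le_sum hterm).trans ?_
    rw [Finset.sum_const, Finset.card_powersetCard, Finset.card_univ, Fintype.card_fin,
      nsmul_eq_mul]
  · intro k _ l _ hkl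
    rw [Function.onFun, Finset.disjoint_left]
    intro A h1 h2
    exact hkl ((Finset.mem_powersetCard.1 h1).2.symm.trans (Finset.mem_powersetCard.1 h2).2)

theorem one_sub_cutSum_le_probRIG_connected {n : ℕ} (hn : 0 < n) (m : ℕ) (p : I) :
    1 - cutSum n m p ≤ probRIG n m p (fun G => G.Connected) := by
  have : Nonempty (Fin n) := ⟨⟨0, hn⟩⟩
  have h := featureLaw_real_not_preconnected_le n m p
  have hc := probReal_add_probReal_compl (μ := featureLaw n m p)
    (s := {W | (intersectionGraph W).Connected}) (measurableSet_featureEvent _)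
  have : {W : Fin n → Set (Fin m) | (intersectionGraph W).Connected}ᶜ =
      {W | ¬ (intersectionGraph W).Preconnected} := by
    ext W
    simp [SimpleGraph.connected_iff, this]
  rw [this] at hc
  rw [probRIG]
  linarith

/-- If every vertex has a feature and the features are connected to each other, where two features
are adjacent if some vertex has both, then the vertices are connected to each other. -/
theorem intersectionGraph_preconnected_of_featureColumns {n m : ℕ} {W : Fin n → Set (Fin m)}
    (h : (intersectionGraph (featureColumns W)).Preconnected) (hW : ∀ v, (W v).Nonempty) :
    (intersectionGraph W).Preconnected := by
  have hstep : ∀ (u v : Fin n) (f : Fin m), f ∈ W u → f ∈ W v →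
      (intersectionGraph W).Reachable u v := by
    intro u v f hu hv
    by_cases huv : u = v
    · rw [huv]
    · exact SimpleGraph.Adj.reachable ⟨huv, f, hu, hv⟩
  have key : ∀ f g : Fin m, (intersectionGraph (featureColumns W)).Walk f g →
      ∀ u v : Fin n, f ∈ W u → g ∈ W v → (intersectionGraph W).Reachable u v := by
    intro f g w
    induction w with
    | nil => intro u v hu hv; exact hstep u v _ hu hv
    | cons hadj _ ih =>
      intro u v hu hv
      obtain ⟨_, x, hx1, hx2⟩ := hadj
      exact (hstep u x _ hu hx1).trans (ih x v hx2 hv)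
  intro u v
  obtain ⟨f, hf⟩ := hW u
  obtain ⟨g, hg⟩ := hW v
  exact key f g (h f g).some u v hf hg

theorem featureLaw_real_exists_empty_le (n m : ℕ) (p : I) :
    (featureLaw n m p).real {W | ∃ v, W v = ∅} ≤ n * (1 - p : ℝ) ^ m := by
  classical
  have hterm : ∀ v : Fin n, (featureLaw n m p).real {W | W v = ∅} = (1 - p : ℝ) ^ m := by
    intro v
    have h := featureLaw_real_forall_mem (n := n) (m := m) p
      (Function.update (fun _ => Set.univ) v {∅})
    have hset : {W : Fin n → Set (Fin m) | ∀ u, W u ∈ Function.update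
        (fun _ => (Set.univ : Set (Set (Fin m)))) v {∅} u} = {W | W v = ∅} := by
      ext W
      simp only [Set.mem_ofPred_eq]
      constructor
      · intro hW; simpa using hW v
      · intro hW u
        by_cases huv : u = v
        · subst huv; simpa using hW
        · simp [huv]
    rw [hset, Finset.prod_eq_single v] at h
    · rw [h, Function.update_self]
      simp
    · intro u _ huv
      simp [huv]
    · simp
  have hset : {W : Fin n → Set (Fin m) | ∃ v, W v = ∅} =
      ⋃ v ∈ (Finset.univ : Finset (Fin n)), {W | W v = ∅} := by
    ext; simp
  rw [hset]
  refine (measureReal_biUnion_finset_le _ _).trans ?_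
  simp [hterm]

/-- The bound for few features: the cuts are those of the graph on the features. -/
theorem one_sub_dual_cutSum_le_probRIG_connected {n : ℕ} (hn : 0 < n) (m : ℕ) (p : I) :
    1 - (cutSum m n p + n * (1 - p : ℝ) ^ m) ≤ probRIG n m p (fun G => G.Connected) := by
  have : Nonempty (Fin n) := ⟨⟨0, hn⟩⟩
  have h1 := featureLaw_real_not_preconnected_le m n p
  rw [← featureLaw_real_featureColumns] at h1
  have h2 := featureLaw_real_exists_empty_le n m p
  have hc := probReal_add_probReal_compl (μ := featureLaw n m p)
    (s := {W | (intersectionGraph W).Connected}) (measurableSet_featureEvent _)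
  have hsub : {W : Fin n → Set (Fin m) | (intersectionGraph W).Connected}ᶜ ⊆
      {W | featureColumns W ∈ {V | ¬ (intersectionGraph V).Preconnected}} ∪
        {W | ∃ v, W v = ∅} := by
    intro W hW
    by_contra hcon
    simp only [Set.mem_union, Set.mem_ofPred_eq, not_or, not_not, not_exists] at hcon
    refine hW ((SimpleGraph.connected_iff _).2 ⟨?_, this⟩)
    exact intersectionGraph_preconnected_of_featureColumns hcon.1
      fun v => Set.nonempty_iff_ne_empty.2 (hcon.2 v)
  have h3 := (measureReal_mono (μ := featureLaw n m p) hsub).trans (measureReal_union_le _ _)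
  rw [probRIG]
  linarith

/-! ### Isolated vertices and the second moment method -/

/-- The second moment bound for the probability that none of the events `E i` occurs, for events
that all have probability `a` and whose pairwise intersections all have probability `b`. -/
theorem measureReal_iInter_compl_le_of_pairwise {Ω ι : Type*} [MeasurableSpace Ω] (P : Measure Ω)
    [IsProbabilityMeasure P] [Fintype ι] [Nonempty ι] (E : ι → Set Ω)
    (hE : ∀ i, MeasurableSet (E i)) {a b : ℝ} (ha : 0 < a) (hb : 0 ≤ b)
    (h1 : ∀ i, P.real (E i) = a) (h2 : ∀ i j, i ≠ j → P.real (E i ∩ E j) = b) :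
    P.real (⋂ i, (E i)ᶜ) ≤ 1 / (Fintype.card ι * a) + (b / a ^ 2 - 1) := by
  classical
  set N : ℝ := (Fintype.card ι : ℝ) with hN
  have hNpos : 0 < N := by rw [hN]; exact_mod_cast Fintype.card_pos
  set X : Ω → ℝ := fun x => ∑ i, (E i).indicator (fun _ => (1 : ℝ)) x with hX
  have hint : ∀ S : Set Ω, MeasurableSet S → Integrable (S.indicator fun _ => (1 : ℝ)) P :=
    fun S hS => (integrable_const (1 : ℝ)).indicator hS
  have hXint : Integrable X P := integrable_finsetSum _ fun i _ => hint _ (hE i)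
  have hXX : ∀ x, X x ^ 2 = ∑ i, ∑ j, (E i ∩ E j).indicator (fun _ => (1 : ℝ)) x := by
    intro x
    rw [hX, sq, Finset.sum_mul_sum]
    refine Finset.sum_congr rfl fun i _ => Finset.sum_congr rfl fun j _ => ?_
    by_cases hi : x ∈ E i <;> by_cases hj : x ∈ E j <;> simp [hi, hj]
  have hXXint : Integrable (fun x => X x ^ 2) P := by
    simp_rw [hXX]
    exact integrable_finsetSum _ fun i _ => integrable_finsetSum _ fun j _ =>
      hint _ ((hE i).inter (hE j))
  have hEX : ∫ x, X x ∂P = N * a := by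
    rw [hX, integral_finsetSum _ fun i _ => hint _ (hE i)]
    simp [integral_indicator_const, hE, h1, hN]
  have hEXX : ∫ x, X x ^ 2 ∂P ≤ N * a + N ^ 2 * b := by
    simp_rw [hXX]
    rw [integral_finsetSum _ fun i _ => integrable_finsetSum _ fun j _ =>
      hint _ ((hE i).inter (hE j))]
    have hrow : ∀ i, ∫ x, ∑ j, (E i ∩ E j).indicator (fun _ => (1 : ℝ)) x ∂P ≤ a + N * b := by
      intro i
      rw [integral_finsetSum _ fun j _ => hint _ ((hE i).inter (hE j))]
      have : ∀ j, ∫ x, (E i ∩ E j).indicator (fun _ => (1 : ℝ)) x ∂P ≤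
          (if i = j then a else 0) + b := by
        intro j
        rw [integral_indicator_const _ ((hE i).inter (hE j))]
        by_cases hij : i = j
        · subst hij; simp [h1, hb]
        · simp [hij, h2 i j hij]
      refine (Finset.sum_le_sum fun j _ => this j).trans ?_
      rw [Finset.sum_add_distrib]
      simp [hN]
    refine (Finset.sum_le_sum fun i _ => hrow i).trans (le_of_eq ?_)
    simp [← hN]
    ring
  have hDint : Integrable (fun x => X x ^ 2 - 2 * (N * a) * X x) P :=
    hXXint.sub (hXint.const_mul _)
  have hYint : Integrable (fun x => (X x - N * a) ^ 2) P := by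
    have : (fun x => (X x - N * a) ^ 2) =
        fun x => (X x ^ 2 - 2 * (N * a) * X x) + (N * a) ^ 2 := by
      ext x; ring
    rw [this]
    exact hDint.add (integrable_const _)
  have hEY : ∫ x, (X x - N * a) ^ 2 ∂P ≤ N * a + N ^ 2 * b - (N * a) ^ 2 := by
    have : (fun x => (X x - N * a) ^ 2) =
        fun x => (X x ^ 2 - 2 * (N * a) * X x) + (N * a) ^ 2 := by
      ext x; ring
    rw [this, integral_add hDint (integrable_const _),
      integral_sub hXXint (hXint.const_mul _), integral_const_mul, hEX]
    simp
    linarith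
  have hmarkov := mul_meas_ge_le_integral_of_nonneg (μ := P)
    (ae_of_all _ fun x => sq_nonneg (X x - N * a)) hYint ((N * a) ^ 2)
  have hsub : (⋂ i, (E i)ᶜ) ⊆ {x | (N * a) ^ 2 ≤ (X x - N * a) ^ 2} := by
    intro x hx
    have hx0 : X x = 0 := by
      rw [hX]
      refine Finset.sum_eq_zero fun i _ => ?_
      simp only [Set.mem_iInter, Set.mem_compl_iff] at hx
      simp [hx i]
    simp [hx0]
  have hfin : (N * a) ^ 2 * P.real (⋂ i, (E i)ᶜ) ≤ N * a + N ^ 2 * b - (N * a) ^ 2 :=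
    (mul_le_mul_of_nonneg_left (measureReal_mono hsub) (sq_nonneg _)).trans
      (hmarkov.trans hEY)
  have hpos : 0 < (N * a) ^ 2 := by positivity
  refine le_of_mul_le_mul_left (hfin.trans (le_of_eq ?_)) hpos
  field_simp
  ring

/-- The vertex sets of a feature for which this feature gives `v` no neighbour. -/
def isolatingColumns {n : ℕ} (v : Fin n) : Set (Set (Fin n)) :=
  {S | v ∉ S ∨ S = {v}}

theorem isIsolated_of_forall_featureColumns_mem {n m : ℕ} {W : Fin n → Set (Fin m)} {v : Fin n}
    (h : ∀ f, featureColumns W f ∈ isolatingColumns v) : (intersectionGraph W).IsIsolated v := by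
  rintro u ⟨hne, f, hv, hu⟩
  rcases h f with h | h
  · exact h hv
  · have : u ∈ featureColumns W f := hu
    rw [h] at this
    exact hne this.symm

theorem setBernoulli_univ_real_singleton_fin {n : ℕ} (p : I) (v : Fin n) :
    (setBernoulli (Set.univ : Set (Fin n)) p).real {{v}} = p * (1 - p : ℝ) ^ (n - 1) := by
  rw [setBernoulli_real_singleton p (Set.subset_univ _) Set.finite_univ]
  have : (Set.univ \ {v} : Set (Fin n)).ncard = n - 1 := by
    rw [Set.ncard_sdiff (Set.subset_univ _)]
    simp
  simp [this]

theorem setBernoulli_univ_real_isolatingColumns {n : ℕ} (p : I) (v : Fin n) :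
    (setBernoulli (Set.univ : Set (Fin n)) p).real (isolatingColumns v) =
      (1 - p) + p * (1 - p : ℝ) ^ (n - 1) := by
  have hset : isolatingColumns v =
      {S : Set (Fin n) | Disjoint S (({v} : Finset (Fin n)) : Set (Fin n))} ∪ {{v}} := by
    ext S; simp [isolatingColumns, or_comm]
  rw [hset, measureReal_union (by simp) (Set.toFinite _).measurableSet,
    setBernoulli_univ_real_disjoint, setBernoulli_univ_real_singleton_fin]
  simp

theorem setBernoulli_univ_real_isolatingColumns_inter {n : ℕ} (p : I) {u v : Fin n}
    (huv : u ≠ v) :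
    (setBernoulli (Set.univ : Set (Fin n)) p).real (isolatingColumns u ∩ isolatingColumns v) =
      (1 - p : ℝ) ^ 2 + 2 * (p * (1 - p : ℝ) ^ (n - 1)) := by
  classical
  have hset : isolatingColumns u ∩ isolatingColumns v =
      ({S : Set (Fin n) | Disjoint S (({u, v} : Finset (Fin n)) : Set (Fin n))} ∪ {{u}}) ∪
        {{v}} := by
    ext S
    simp only [isolatingColumns, Set.mem_inter_iff, Set.mem_ofPred_eq, Set.mem_union,
      Set.mem_singleton_iff, Finset.coe_insert, Finset.coe_singleton, Set.disjoint_insert_right,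
      Set.disjoint_singleton_right]
    constructor
    · rintro ⟨h1 | h1, h2 | h2⟩ <;> tauto
    · rintro ((h | rfl) | rfl)
      · tauto
      · simp [huv.symm]
      · simp [huv]
  rw [hset, measureReal_union _ (Set.toFinite _).measurableSet,
    measureReal_union _ (Set.toFinite _).measurableSet,
    setBernoulli_univ_real_disjoint, setBernoulli_univ_real_singleton_fin,
    setBernoulli_univ_real_singleton_fin, Finset.card_pair huv]
  · ring
  · simp
  · simp [huv.symm]

theorem exp_neg_add_two_mul_sq_le_one_sub {x : ℝ} (hx : x ≤ 1 / 2) :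
    Real.exp (-(x + 2 * x ^ 2)) ≤ 1 - x := by
  have hpos : 0 < 1 - x := by linarith
  rw [← Real.le_log_iff_exp_le hpos]
  refine le_trans ?_ (Real.one_sub_inv_le_log_of_pos hpos)
  have : (1 - x)⁻¹ ≤ 1 + x + 2 * x ^ 2 := by
    rw [inv_le_iff_one_le_mul₀ hpos]
    nlinarith [mul_nonneg (sq_nonneg x) (by linarith : 0 ≤ 1 - 2 * x)]
  linarith

/-- The second moment method for the number of isolated vertices. The number `x` bounds the
probability that a given feature provides a given vertex with a neighbour; both `p` and `n p ^ 2`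
are such bounds. -/
theorem probRIG_connected_le {n : ℕ} (hn : 2 ≤ n) (m : ℕ) (p : I) (hp : (p : ℝ) ≤ 1 / 2) {x : ℝ}
    (hx : x ≤ 1 / 2) (hpx : (p : ℝ) ≤ x ∨ (n : ℝ) * (p : ℝ) ^ 2 ≤ x) :
    probRIG n m p (fun G => G.Connected) ≤
      Real.exp (m * x + 2 * (m * x ^ 2)) / n + (Real.exp (8 * (m * (p : ℝ) ^ 2)) - 1) := by
  have hp0 : (0 : ℝ) ≤ p := p.2.1
  have hp1 : (p : ℝ) ≤ 1 := p.2.2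
  have hx0 : 0 ≤ x := by
    rcases hpx with h | h
    · linarith
    · exact le_trans (by positivity) h
  have : Nonempty (Fin n) := ⟨⟨0, by omega⟩⟩
  have : Nontrivial (Fin n) := Fin.nontrivial_iff_two_le.2 hn
  set q : ℝ := (1 - p : ℝ) ^ (n - 1) with hq
  have hq0 : 0 ≤ q := pow_nonneg (by linarith) _
  have hq1 : q ≤ 1 := pow_le_one₀ (by linarith) (by linarith)
  have hqn : 1 - n * (p : ℝ) ≤ q := by
    have h := one_add_mul_le_pow (a := -(p : ℝ)) (by linarith) (n - 1)
    have h2 : ((n - 1 : ℕ) : ℝ) ≤ n := by exact_mod_cast Nat.sub_le n 1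
    have h3 : (1 + -(p : ℝ)) ^ (n - 1) = q := by rw [hq]; ring
    rw [h3] at h
    nlinarith
  set A : ℝ := (1 - p) + p * q with hA
  set B : ℝ := (1 - p : ℝ) ^ 2 + 2 * (p * q) with hB
  have hAx : 1 - x ≤ A := by
    rcases hpx with h | h
    · nlinarith
    · nlinarith
  have hA2 : 1 / 2 ≤ A := by linarith
  have hA0 : 0 < A := by linarith
  have hBA : B ≤ A ^ 2 * (1 + 8 * (p : ℝ) ^ 2) := by
    have h1 : B ≤ A ^ 2 + 2 * (p : ℝ) ^ 2 := by
      have : 0 ≤ (p : ℝ) ^ 2 * (2 - 2 * q + q ^ 2) := by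
        refine mul_nonneg (sq_nonneg _) ?_
        nlinarith
      have e : A ^ 2 + 2 * (p : ℝ) ^ 2 - B = (p : ℝ) ^ 2 * (2 - 2 * q + q ^ 2) := by
        rw [hA, hB]; ring
      linarith
    have h2 : 1 / 4 ≤ A ^ 2 := by nlinarith
    nlinarith [sq_nonneg (p : ℝ)]
  have hB0 : 0 ≤ B := by positivity
  set E : Fin n → Set (Fin n → Set (Fin m)) :=
    fun v => {W | ∀ f, featureColumns W f ∈ isolatingColumns v}
  have hE1 : ∀ v, (featureLaw n m p).real (E v) = A ^ m := by
    intro v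
    rw [featureLaw_real_forall_featureColumns_mem, setBernoulli_univ_real_isolatingColumns]
  have hE2 : ∀ u v, u ≠ v → (featureLaw n m p).real (E u ∩ E v) = B ^ m := by
    intro u v huv
    have : E u ∩ E v =
        {W | ∀ f, featureColumns W f ∈ isolatingColumns u ∩ isolatingColumns v} := by
      ext W
      simp only [E, Set.mem_inter_iff, Set.mem_ofPred_eq, forall_and]
    rw [this, featureLaw_real_forall_featureColumns_mem,
      setBernoulli_univ_real_isolatingColumns_inter p huv]
  have hmain := measureReal_iInter_compl_le_of_pairwise (featureLaw n m p) E
    (fun _ => measurableSet_featureEvent _) (pow_pos hA0 m) (pow_nonneg hB0 m) hE1 hE2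
  have hsub : {W : Fin n → Set (Fin m) | (intersectionGraph W).Connected} ⊆ ⋂ v, (E v)ᶜ := by
    intro W hW
    simp only [Set.mem_iInter, Set.mem_compl_iff]
    intro v hv
    exact hW.preconnected.not_isIsolated v (isIsolated_of_forall_featureColumns_mem hv)
  refine (measureReal_mono hsub).trans (hmain.trans (add_le_add ?_ ?_))
  · rw [Fintype.card_fin]
    have hAm : Real.exp (-(m * x + 2 * (m * x ^ 2))) ≤ A ^ m := by
      have : -(m * x + 2 * (m * x ^ 2)) = m * (-(x + 2 * x ^ 2)) := by ring
      rw [this, Real.exp_nat_mul]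
      exact pow_le_pow_left₀ (Real.exp_pos _).le
        ((exp_neg_add_two_mul_sq_le_one_sub hx).trans hAx) m
    have hnpos : (0 : ℝ) < n := by exact_mod_cast (by omega : 0 < n)
    have h1 : 1 ≤ A ^ m * Real.exp (m * x + 2 * (m * x ^ 2)) := by
      calc (1 : ℝ) = Real.exp (-(m * x + 2 * (m * x ^ 2))) * Real.exp (m * x + 2 * (m * x ^ 2)) := by
            rw [← Real.exp_add]; simp
        _ ≤ _ := by gcongr
    rw [div_le_div_iff₀ (by positivity) hnpos]
    nlinarith
  · have h1 : B ^ m / (A ^ m) ^ 2 ≤ Real.exp (8 * (m * (p : ℝ) ^ 2)) := by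
      rw [div_le_iff₀ (by positivity)]
      calc B ^ m ≤ (A ^ 2 * (1 + 8 * (p : ℝ) ^ 2)) ^ m := pow_le_pow_left₀ hB0 hBA m
        _ = (1 + 8 * (p : ℝ) ^ 2) ^ m * (A ^ m) ^ 2 := by rw [mul_pow, pow_right_comm, mul_comm]
        _ ≤ Real.exp (8 * (p : ℝ) ^ 2) ^ m * (A ^ m) ^ 2 := by
            gcongr
            rw [add_comm]
            exact Real.add_one_le_exp _
        _ = _ := by rw [← Real.exp_nat_mul]; ring_nf
    linarith

/-! ### Estimates for the cut sum -/

/-- The probability of meeting a set of `N - k` vertices is at least the fraction `1 - k / N` of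
that for `N` vertices. -/
theorem mul_one_sub_pow_le_one_sub_pow_sub {r : ℝ} (h0 : 0 ≤ r) {k N : ℕ}
    (hN : 0 < N) (hk : k ≤ N) : (1 - k / N) * (1 - r ^ N) ≤ 1 - r ^ (N - k) := by
  have hN' : (0 : ℝ) < N := by exact_mod_cast hN
  have hk' : (k : ℝ) ≤ N := by exact_mod_cast hk
  have hj : 0 ≤ 1 - (k : ℝ) / N := by rw [sub_nonneg, div_le_one hN']; exact hk'
  -- Bernoulli's inequality for the exponent `(N - k) / N ≤ 1`
  have h := rpow_one_add_le_one_add_mul_self (s := r ^ N - 1) (p := 1 - (k : ℝ) / N)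
    (by have := pow_nonneg h0 N; linarith) hj (by have : 0 ≤ (k : ℝ) / N := by positivity
                                                  linarith)
  have he : (1 + (r ^ N - 1)) ^ (1 - (k : ℝ) / N) = r ^ (N - k) := by
    rw [add_sub_cancel, ← Real.rpow_natCast r N, ← Real.rpow_mul h0, ← Real.rpow_natCast]
    congr 1
    rw [Nat.cast_sub hk]
    field_simp
  rw [he] at h
  linarith

theorem one_sub_pow_le_exp_neg_mul {q : ℝ} (hq : q ≤ 1) (k : ℕ) :
    (1 - q) ^ k ≤ Real.exp (-(k * q)) := by
  rw [← mul_neg, Real.exp_nat_mul]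
  exact pow_le_pow_left₀ (by linarith) (Real.one_sub_le_exp_neg q) k

theorem exp_neg_le_one_sub_add_sq_div_two {x : ℝ} (hx : 0 ≤ x) :
    Real.exp (-x) ≤ 1 - x + x ^ 2 / 2 := by
  have h := Real.quadratic_le_exp_of_nonneg hx
  rw [Real.exp_neg, inv_le_iff_one_le_mul₀ (Real.exp_pos x)]
  have h2 : 0 ≤ 1 - x + x ^ 2 / 2 := by nlinarith [sq_nonneg (x - 1)]
  nlinarith [mul_le_mul_of_nonneg_left h h2, sq_nonneg (x ^ 2)]

theorem exp_neg_three_le : Real.exp (-3) ≤ 0.06 := by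
  have h := Real.exp_one_gt_d9
  have h3 : Real.exp 3 = Real.exp 1 ^ 3 := by rw [← Real.exp_nat_mul]; norm_num
  rw [Real.exp_neg, h3, inv_le_comm₀ (by positivity) (by norm_num)]
  calc (0.06 : ℝ)⁻¹ ≤ 2.7 ^ 3 := by norm_num
    _ ≤ _ := by gcongr; linarith

theorem exp_neg_le_one_sub_of_le_three {x : ℝ} (h0 : 0 ≤ x) (h3 : x ≤ 3) :
    Real.exp (-x) ≤ 1 - 0.3 * x := by
  have h := convexOn_exp.2 (Set.mem_univ 0) (Set.mem_univ (-3))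
    (by linarith : 0 ≤ 1 - x / 3) (by positivity : 0 ≤ x / 3) (by ring)
  simp only [smul_eq_mul, mul_zero, zero_add, Real.exp_zero, mul_one] at h
  have e : x / 3 * -3 = -x := by ring
  rw [e] at h
  nlinarith [exp_neg_three_le]

theorem choose_le_exp_mul_log {N k : ℕ} (hN : 0 < N) :
    (N.choose k : ℝ) ≤ Real.exp (k * Real.log N) := by
  have hN' : (0 : ℝ) < N := by exact_mod_cast hN
  rw [Real.exp_nat_mul, Real.exp_log hN']
  exact_mod_cast Nat.choose_le_pow N k

theorem choose_le_exp_mul_one_add_log {N k : ℕ} {B : ℝ} (hk : 0 < k) (hB : 0 < B)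
    (hN : (N : ℝ) ≤ k * B) : (N.choose k : ℝ) ≤ Real.exp (k * (1 + Real.log B)) := by
  have hk' : (0 : ℝ) < k := by exact_mod_cast hk
  have hfac : (0 : ℝ) < k.factorial := by exact_mod_cast k.factorial_pos
  have h1 : (N.choose k : ℝ) ≤ N ^ k / k.factorial := Nat.choose_le_pow_div k N
  have h2 : (k : ℝ) ^ k / k.factorial ≤ Real.exp k := Real.pow_div_factorial_le_exp _ hk'.le k
  calc (N.choose k : ℝ) ≤ N ^ k / k.factorial := h1
    _ ≤ (k * B) ^ k / k.factorial := by gcongr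
    _ = (k : ℝ) ^ k / k.factorial * B ^ k := by rw [mul_pow]; ring
    _ ≤ Real.exp k * B ^ k := by gcongr
    _ = _ := by
      rw [mul_add, Real.exp_add, mul_one, Real.exp_nat_mul (Real.log B), Real.exp_log hB]

theorem choose_le_exp_mul_log_two (N k : ℕ) :
    (N.choose k : ℝ) ≤ Real.exp (0.694 * N) := by
  have h2 := Real.log_two_lt_d9
  calc (N.choose k : ℝ) ≤ 2 ^ N := by exact_mod_cast Nat.choose_le_two_pow N k
    _ = Real.exp (N * Real.log 2) := by rw [Real.exp_nat_mul, Real.exp_log (by norm_num)]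
    _ ≤ _ := by
      rw [mul_comm]
      gcongr
      linarith

/-- A term of the cut sum for small sets, of at most `N / (log N) ^ 2` vertices: the exponent is
nearly `k` times that of an isolated vertex. -/
theorem cutSum_term_le_of_small {N M k : ℕ} {q w T : ℝ} (hk : 1 ≤ k) (hkN : k ≤ N)
    (hq0 : 0 ≤ q) (hq1 : q ≤ 1) (hL : 6 ≤ Real.log N) (hT : 0 ≤ T) (hw : 2 * T + 6 ≤ w)
    (hqN : N * q ≤ 3 * Real.log N) (hΛ : Real.log N + w ≤ M * q * (1 - (1 - q) ^ N))
    (hsmall : k * Real.log N ^ 2 ≤ N) :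
    (N.choose k : ℝ) * Real.exp (-(M * ((1 - (1 - q) ^ k) * (1 - (1 - q) ^ (N - k))))) ≤
      Real.exp (-(k * T)) := by
  set L := Real.log N with hLdef
  have hN : 0 < N := by omega
  have hN' : (0 : ℝ) < N := by exact_mod_cast hN
  have hk' : (0 : ℝ) < k := by exact_mod_cast hk
  have hψ0 : 0 ≤ 1 - (1 - q) ^ N :=
    sub_nonneg.2 (pow_le_one₀ (by linarith) (by linarith))
  have hψk := mul_one_sub_pow_le_one_sub_pow_sub (r := 1 - q) (by linarith) hN hkN
  have hkψ : k * q * (1 - k * q / 2) ≤ 1 - (1 - q) ^ k := by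
    have h1 := one_sub_pow_le_exp_neg_mul hq1 k
    have h2 := exp_neg_le_one_sub_add_sq_div_two (x := k * q) (by positivity)
    linarith
  -- the two correction factors together cost at most `2 / L`
  have hkN1 : (k : ℝ) / N ≤ 1 / (6 * L) := by
    rw [div_le_div_iff₀ hN' (by positivity)]
    nlinarith
  have hkq : k * q ≤ 3 / L := by
    rw [le_div_iff₀ (by linarith)]
    have : N * (k * q * L) ≤ N * 3 := by
      calc N * (k * q * L) = (N * q) * (k * L) := by ring
        _ ≤ (3 * L) * (k * L) := by gcongr
        _ = 3 * (k * L ^ 2) := by ring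
        _ ≤ 3 * N := by gcongr
        _ = N * 3 := by ring
    exact le_of_mul_le_mul_left this hN'
  have hL1 : 1 / L ≤ 1 / 6 := one_div_le_one_div_of_le (by norm_num) hL
  have h3L : 3 / L = 3 * (1 / L) := by ring
  have h6L : 1 / (6 * L) = 1 / 6 * (1 / L) := by field_simp
  have hLpos : 0 < 1 / L := by positivity
  have hfac : 1 - 2 / L ≤ (1 - k * q / 2) * (1 - k / N) := by
    have e : 2 / L = 2 * (1 / L) := by ring
    have : 0 ≤ k * q / 2 * (k / N) := by positivity
    nlinarith
  have hE : k * (L + T) ≤ M * ((1 - (1 - q) ^ k) * (1 - (1 - q) ^ (N - k))) := by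
    have hkN2 : 0 ≤ 1 - (k : ℝ) / N := by linarith
    calc k * (L + T) ≤ k * ((L + w) * (1 - 2 / L)) := by
          gcongr
          have e : (L + w) * (1 - 2 / L) = L + w - 2 - 2 * w * (1 / L) := by
            field_simp
            ring
          rw [e]
          have : w * (1 / L) ≤ w * (1 / 6) := by gcongr; linarith
          linarith
      _ ≤ k * ((M * q * (1 - (1 - q) ^ N)) * ((1 - k * q / 2) * (1 - k / N))) := by
          have : 0 ≤ 1 - 2 / L := by
            have e : 2 / L = 2 * (1 / L) := by ring
            linarith
          have : 0 ≤ L + w := by linarith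
          gcongr
      _ = M * ((k * q * (1 - k * q / 2)) * ((1 - k / N) * (1 - (1 - q) ^ N))) := by ring
      _ ≤ _ := by
          have h1 : 0 ≤ 1 - k * q / 2 := by linarith
          have h2 : 0 ≤ 1 - (1 - q) ^ k := le_trans (by positivity) hkψ
          gcongr
  calc (N.choose k : ℝ) * Real.exp (-(M * ((1 - (1 - q) ^ k) * (1 - (1 - q) ^ (N - k)))))
      ≤ Real.exp (k * L) * Real.exp (-(k * (L + T))) := by
        gcongr
        exact choose_le_exp_mul_log hN
    _ = _ := by rw [← Real.exp_add]; ring_nf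

/-- A term of the cut sum for the sets of more than `N / (log N) ^ 2` but at most `3 / q`
vertices. -/
theorem cutSum_term_le_of_medium {N M k : ℕ} {q w T : ℝ} (hk : 1 ≤ k) (hkN : 2 * k ≤ N)
    (hq0 : 0 ≤ q) (hq1 : q ≤ 1) (hL : 6 ≤ Real.log N) (hw : 0 ≤ w)
    (hLT : T + 1 + 2 * Real.log (Real.log N) ≤ 0.15 * Real.log N)
    (hΛ : Real.log N + w ≤ M * q * (1 - (1 - q) ^ N))
    (hlarge : N ≤ k * Real.log N ^ 2) (hkq : k * q ≤ 3) :
    (N.choose k : ℝ) * Real.exp (-(M * ((1 - (1 - q) ^ k) * (1 - (1 - q) ^ (N - k))))) ≤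
      Real.exp (-(k * T)) := by
  set L := Real.log N with hLdef
  have hN : 0 < N := by omega
  have hN' : (0 : ℝ) < N := by exact_mod_cast hN
  have hk' : (0 : ℝ) < k := by exact_mod_cast hk
  have hkN' : 2 * (k : ℝ) ≤ N := by exact_mod_cast hkN
  have hψ0 : 0 ≤ 1 - (1 - q) ^ N :=
    sub_nonneg.2 (pow_le_one₀ (by linarith) (by linarith))
  have hψk : 1 / 2 * (1 - (1 - q) ^ N) ≤ 1 - (1 - q) ^ (N - k) := by
    refine le_trans ?_ (mul_one_sub_pow_le_one_sub_pow_sub (r := 1 - q) (by linarith)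
      hN (by omega : k ≤ N))
    have : (k : ℝ) / N ≤ 1 / 2 := by rw [div_le_div_iff₀ hN' (by norm_num)]; linarith
    gcongr
    linarith
  have hkψ : 0.3 * (k * q) ≤ 1 - (1 - q) ^ k := by
    have h1 := one_sub_pow_le_exp_neg_mul hq1 k
    have h2 := exp_neg_le_one_sub_of_le_three (x := k * q) (by positivity) hkq
    linarith
  have hE : k * (0.15 * L) ≤ M * ((1 - (1 - q) ^ k) * (1 - (1 - q) ^ (N - k))) := by
    calc k * (0.15 * L) ≤ k * (0.15 * (M * q * (1 - (1 - q) ^ N))) := by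
          gcongr
          linarith
      _ = M * ((0.3 * (k * q)) * (1 / 2 * (1 - (1 - q) ^ N))) := by ring
      _ ≤ _ := by
          have h2 : 0 ≤ 1 - (1 - q) ^ k := le_trans (by positivity) hkψ
          gcongr
  calc (N.choose k : ℝ) * Real.exp (-(M * ((1 - (1 - q) ^ k) * (1 - (1 - q) ^ (N - k)))))
      ≤ Real.exp (k * (1 + Real.log (L ^ 2))) * Real.exp (-(k * (0.15 * L))) := by
        gcongr
        exact choose_le_exp_mul_one_add_log hk (by positivity) hlarge
    _ = Real.exp (-(k * (0.15 * L - (1 + 2 * Real.log L)))) := by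
        rw [← Real.exp_add, Real.log_pow]
        congr 1
        push_cast
        ring
    _ ≤ _ := by
        gcongr
        linarith

/-- A term of the cut sum for the sets of more than `3 / q` vertices: most features meet both sides
of the cut, and there are fewer than `2 ^ N` cuts. -/
theorem cutSum_term_le_of_large {N M k : ℕ} {q : ℝ} (hkN : 2 * k ≤ N) (hq0 : 0 ≤ q)
    (hq1 : q ≤ 1) (hM : 0.9 * (N : ℝ) ≤ M) (hkq : 3 ≤ k * q) :
    (N.choose k : ℝ) * Real.exp (-(M * ((1 - (1 - q) ^ k) * (1 - (1 - q) ^ (N - k))))) ≤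
      Real.exp (-(0.1 * N)) := by
  have h : ∀ j : ℕ, k ≤ j → 0.94 ≤ 1 - (1 - q) ^ j := by
    intro j hj
    have h1 := one_sub_pow_le_exp_neg_mul hq1 j
    have hj' : (k : ℝ) ≤ j := by exact_mod_cast hj
    have h2 : Real.exp (-(j * q)) ≤ Real.exp (-3) := by
      gcongr
      nlinarith
    have := exp_neg_three_le
    linarith
  have h1 := h k le_rfl
  have h2 := h (N - k) (by omega)
  have hE : 0.794 * (N : ℝ) ≤ M * ((1 - (1 - q) ^ k) * (1 - (1 - q) ^ (N - k))) := by
    calc 0.794 * (N : ℝ) ≤ (0.9 * (N : ℝ)) * (0.94 * 0.94) := by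
          have : (0 : ℝ) ≤ N := Nat.cast_nonneg N
          linarith
      _ ≤ _ := by
          have : 0 ≤ 1 - (1 - q) ^ k := by linarith
          gcongr
  calc (N.choose k : ℝ) * Real.exp (-(M * ((1 - (1 - q) ^ k) * (1 - (1 - q) ^ (N - k)))))
      ≤ Real.exp (0.694 * N) * Real.exp (-(0.794 * N)) := by
        gcongr
        exact choose_le_exp_mul_log_two N k
    _ = _ := by rw [← Real.exp_add]; ring_nf

/-- The three ranges of `k` together. The summand with `N` bounds the terms of the sets of more
than `3 / q` vertices. -/
theorem cutSum_le {N M : ℕ} {q w T : ℝ} (hq0 : 0 ≤ q) (hq1 : q ≤ 1) (hL : 6 ≤ Real.log N)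
    (hT : 1 ≤ T) (hw : 2 * T + 6 ≤ w)
    (hLT : T + 1 + 2 * Real.log (Real.log N) ≤ 0.15 * Real.log N)
    (hM : 0.9 * (N : ℝ) ≤ M) (hqN : N * q ≤ 3 * Real.log N)
    (hΛ : Real.log N + w ≤ M * q * (1 - (1 - q) ^ N)) :
    cutSum N M q ≤ 2 * Real.exp (-T) + N * Real.exp (-(0.1 * N)) := by
  have hterm : ∀ k ∈ Finset.Icc 1 (N / 2),
      (N.choose k : ℝ) * Real.exp (-(M * ((1 - (1 - q) ^ k) * (1 - (1 - q) ^ (N - k))))) ≤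
        Real.exp (-T) ^ k + Real.exp (-(0.1 * N)) := by
    intro k hk
    obtain ⟨hk1, hk2⟩ := Finset.mem_Icc.1 hk
    have hkN : 2 * k ≤ N := by omega
    have e : Real.exp (-T) ^ k = Real.exp (-(k * T)) := by rw [← Real.exp_nat_mul, mul_neg]
    rw [e]
    have p1 := Real.exp_pos (-(k * T))
    have p2 := Real.exp_pos (-(0.1 * (N : ℝ)))
    rcases le_total (k * q) 3 with hkq | hkq
    · refine le_trans ?_ (le_add_of_nonneg_right p2.le)
      rcases le_total (k * Real.log N ^ 2) (N : ℝ) with h | h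
      · exact cutSum_term_le_of_small hk1 (by omega) hq0 hq1 hL (by linarith) hw hqN hΛ h
      · exact cutSum_term_le_of_medium hk1 hkN hq0 hq1 hL (by linarith) hLT hΛ h hkq
    · exact (cutSum_term_le_of_large hkN hq0 hq1 hM hkq).trans (le_add_of_nonneg_left p1.le)
  refine (Finset.sum_le_sum hterm).trans ?_
  rw [Finset.sum_add_distrib]
  have hexp : Real.exp (-T) ≤ 1 / 2 := by
    have h1 : Real.exp (-T) ≤ Real.exp (-1) := by gcongr
    have h2 := Real.exp_neg_one_lt_d9
    linarith
  have hgeom : ∑ k ∈ Finset.Icc 1 (N / 2), Real.exp (-T) ^ k ≤ 2 * Real.exp (-T) := by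
    have h := geom_sum_Ico_le_of_lt_one (m := 1) (n := N / 2 + 1) (Real.exp_pos (-T)).le
      (by linarith)
    have e : Finset.Ico 1 (N / 2 + 1) = Finset.Icc 1 (N / 2) := by ext; simp
    rw [e] at h
    refine h.trans ?_
    rw [pow_one, div_le_iff₀ (by linarith)]
    nlinarith [Real.exp_pos (-T)]
  refine add_le_add hgeom ?_
  rw [Finset.sum_const, Nat.card_Icc, nsmul_eq_mul]
  gcongr
  omega

/-- The cut sum tends to `0` if the expected number of isolated vertices does: the latter is about
`N * exp (-(M * q * (1 - (1 - q) ^ N)))`. -/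
theorem tendsto_cutSum {N M : ℕ → ℕ} {q : ℕ → ℝ} (hN : Tendsto N atTop atTop)
    (hq0 : ∀ᶠ n in atTop, 0 ≤ q n) (hq1 : ∀ᶠ n in atTop, q n ≤ 1)
    (hM : ∀ᶠ n in atTop, 0.9 * (N n : ℝ) ≤ M n)
    (hqN : ∀ᶠ n in atTop, N n * q n ≤ 3 * Real.log (N n))
    (hΛ : Tendsto (fun n => M n * q n * (1 - (1 - q n) ^ N n) - Real.log (N n)) atTop atTop) :
    Tendsto (fun n => cutSum (N n) (M n) (q n)) atTop (𝓝 0) := by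
  have hNr : Tendsto (fun n => (N n : ℝ)) atTop atTop := tendsto_natCast_atTop_atTop.comp hN
  have hL : Tendsto (fun n => Real.log (N n)) atTop atTop := Real.tendsto_log_atTop.comp hNr
  have hNexp : Tendsto (fun n => (N n : ℝ) * Real.exp (-(0.1 * N n))) atTop (𝓝 0) := by
    have h := (Real.tendsto_pow_mul_exp_neg_atTop_nhds_zero 1).comp
      (hNr.const_mul_atTop (by norm_num : (0 : ℝ) < 0.1))
    have h2 := h.const_mul 10
    rw [mul_zero] at h2
    refine h2.congr fun n => ?_
    simp only [Function.comp_apply]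
    ring
  rw [Metric.tendsto_nhds]
  intro ε hε
  have hTlim : Tendsto (fun T : ℝ => 2 * Real.exp (-T)) atTop (𝓝 0) := by
    simpa using (Real.tendsto_exp_neg_atTop_nhds_zero).const_mul 2
  obtain ⟨T, hT1, hT⟩ := ((eventually_ge_atTop (1 : ℝ)).and
    (hTlim.eventually (gt_mem_nhds (half_pos hε)))).exists
  have hLT : ∀ᶠ L : ℝ in atTop, T + 1 + 2 * Real.log L ≤ 0.15 * L := by
    filter_upwards [Real.isLittleO_log_id_atTop.bound (by norm_num : (0 : ℝ) < 0.05),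
      eventually_ge_atTop (1 : ℝ), eventually_ge_atTop (20 * (T + 1))] with L h1 h2 h3
    rw [Real.norm_eq_abs, Real.norm_eq_abs, id, abs_of_nonneg (by linarith : 0 ≤ L)] at h1
    have := le_abs_self (Real.log L)
    linarith
  filter_upwards [hq0, hq1, hM, hqN, hL.eventually hLT, hL.eventually (eventually_ge_atTop 6),
    hΛ.eventually (eventually_ge_atTop (2 * T + 6)),
    hNexp.eventually (gt_mem_nhds (half_pos hε))] with n h1 h2 h3 h4 h5 h6 h7 h8
  have h := cutSum_le (w := 2 * T + 6) h1 h2 h6 hT1 le_rfl h5 h3 h4 (by linarith)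
  rw [Real.dist_eq, sub_zero, abs_of_nonneg (cutSum_nonneg _ _ _)]
  linarith

/-- In the regime `N * q → 0` the number of isolated vertices is governed by `N * M * q ^ 2`. -/
theorem tendsto_cutSum_of_sparse {N M : ℕ → ℕ} {q : ℕ → ℝ} (hN : Tendsto N atTop atTop)
    (hq0 : ∀ᶠ n in atTop, 0 ≤ q n) (hM : ∀ᶠ n in atTop, 0.9 * (N n : ℝ) ≤ M n)
    (hNq : ∀ᶠ n in atTop, N n * q n ≤ 1)
    (hw : Tendsto (fun n => N n * M n * q n ^ 2 - Real.log (N n)) atTop atTop)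
    (hsmall : ∀ᶠ n in atTop, N n * M n * q n ^ 2 * (N n * q n) ≤ 1) :
    Tendsto (fun n => cutSum (N n) (M n) (q n)) atTop (𝓝 0) := by
  have hNr : Tendsto (fun n => (N n : ℝ)) atTop atTop := tendsto_natCast_atTop_atTop.comp hN
  have hL : Tendsto (fun n => Real.log (N n)) atTop atTop := Real.tendsto_log_atTop.comp hNr
  have hq1 : ∀ᶠ n in atTop, q n ≤ 1 := by
    filter_upwards [hq0, hNq, hNr.eventually (eventually_ge_atTop 1)] with n h1 h2 h3
    nlinarith
  refine tendsto_cutSum hN hq0 hq1 hM ?_ ?_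
  · filter_upwards [hNq, hL.eventually (eventually_ge_atTop 1)] with n h1 h2
    linarith
  · refine tendsto_atTop_mono' _ ?_ (tendsto_atTop_add_const_right _ (-1) hw)
    filter_upwards [hq0, hq1, hsmall] with n h1 h2 h3
    have h4 := one_sub_pow_le_exp_neg_mul h2 (N n)
    have h5 := exp_neg_le_one_sub_add_sq_div_two (x := N n * q n) (by positivity)
    have h6 : M n * q n * (N n * q n - (N n * q n) ^ 2 / 2) ≤
        M n * q n * (1 - (1 - q n) ^ N n) :=
      mul_le_mul_of_nonneg_left (by linarith) (by positivity)
    have e : M n * q n * (N n * q n - (N n * q n) ^ 2 / 2) =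
        N n * M n * q n ^ 2 - N n * M n * q n ^ 2 * (N n * q n) / 2 := by ring
    linarith

/-! ### The number of features and its growth -/

theorem tendsto_log_pow_mul_rpow_neg (k : ℕ) {s : ℝ} (hs : 0 < s) :
    Tendsto (fun n : ℕ => Real.log n ^ k * (n : ℝ) ^ (-s)) atTop (𝓝 0) := by
  have h := (isLittleO_log_rpow_rpow_atTop (k : ℝ) hs).tendsto_div_nhds_zero.comp
    tendsto_natCast_atTop_atTop
  refine h.congr fun n => ?_
  simp only [Function.comp_apply, Real.rpow_natCast]
  rw [Real.rpow_neg (Nat.cast_nonneg n), div_eq_mul_inv]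

theorem tendsto_log_natCast : Tendsto (fun n : ℕ => Real.log n) atTop atTop :=
  Real.tendsto_log_atTop.comp tendsto_natCast_atTop_atTop

theorem eventually_rpow_bounds {α : ℝ} (hα : 0 < α) {m : ℕ → ℕ}
    (hm : ∀ᶠ n : ℕ in atTop, |(m n : ℝ) - (n : ℝ) ^ α| < 1) :
    ∀ᶠ n : ℕ in atTop, (n : ℝ) ^ α / 2 ≤ m n ∧ (m n : ℝ) ≤ 2 * (n : ℝ) ^ α := by
  have h := (tendsto_rpow_atTop hα).comp (tendsto_natCast_atTop_atTop (R := ℝ))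
  filter_upwards [hm, h.eventually (eventually_ge_atTop 2)] with n h1 h2
  simp only [Function.comp_apply] at h2
  rw [abs_lt] at h1
  constructor <;> linarith

theorem tendsto_atTop_of_abs_sub_rpow_lt {α : ℝ} (hα : 0 < α) {m : ℕ → ℕ}
    (hm : ∀ᶠ n : ℕ in atTop, |(m n : ℝ) - (n : ℝ) ^ α| < 1) : Tendsto m atTop atTop := by
  rw [← tendsto_natCast_atTop_iff (R := ℝ)]
  have h := (tendsto_rpow_atTop hα).comp (tendsto_natCast_atTop_atTop (R := ℝ))
  refine tendsto_atTop_mono' _ ?_ (h.atTop_div_const (by norm_num : (0 : ℝ) < 2))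
  filter_upwards [eventually_rpow_bounds hα hm] with n hn
  exact hn.1

theorem tendsto_log_pow_div {α : ℝ} (hα : 0 < α) {m : ℕ → ℕ}
    (hm : ∀ᶠ n : ℕ in atTop, |(m n : ℝ) - (n : ℝ) ^ α| < 1) (k : ℕ) :
    Tendsto (fun n : ℕ => Real.log n ^ k / m n) atTop (𝓝 0) := by
  have h := (tendsto_log_pow_mul_rpow_neg k hα).const_mul 2
  rw [mul_zero] at h
  refine squeeze_zero' (Eventually.of_forall fun n => ?_) ?_ h
  · have := Real.log_natCast_nonneg n
    positivity
  · filter_upwards [eventually_rpow_bounds hα hm, eventually_gt_atTop 0] with n hn hn0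
    have hn' : (0 : ℝ) < n := by exact_mod_cast hn0
    have hlog := Real.log_natCast_nonneg n
    have hpos : 0 < (n : ℝ) ^ α := by positivity
    rw [Real.rpow_neg hn'.le]
    calc Real.log n ^ k / m n ≤ Real.log n ^ k / ((n : ℝ) ^ α / 2) := by
          gcongr
          exact hn.1
      _ = _ := by field_simp

theorem tendsto_log_pow_mul_div_of_one_lt {α : ℝ} (hα : 1 < α) {m : ℕ → ℕ}
    (hm : ∀ᶠ n : ℕ in atTop, |(m n : ℝ) - (n : ℝ) ^ α| < 1) (k : ℕ) :
    Tendsto (fun n : ℕ => Real.log n ^ k * (n / m n)) atTop (𝓝 0) := by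
  have h := (tendsto_log_pow_mul_rpow_neg k (sub_pos.2 hα)).const_mul 2
  rw [mul_zero] at h
  refine squeeze_zero' (Eventually.of_forall fun n => ?_) ?_ h
  · have := Real.log_natCast_nonneg n
    positivity
  · filter_upwards [eventually_rpow_bounds (by linarith) hm, eventually_gt_atTop 0] with n hn hn0
    have hn' : (0 : ℝ) < n := by exact_mod_cast hn0
    have hlog := Real.log_natCast_nonneg n
    have hpos : 0 < (n : ℝ) ^ α := by positivity
    rw [neg_sub, Real.rpow_sub hn', Real.rpow_one]
    calc Real.log n ^ k * (n / m n) ≤ Real.log n ^ k * (n / ((n : ℝ) ^ α / 2)) := by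
          gcongr
          exact hn.1
      _ = _ := by field_simp

theorem tendsto_log_pow_mul_div_of_lt_one {α : ℝ} (hα : 0 < α) (hα1 : α < 1) {m : ℕ → ℕ}
    (hm : ∀ᶠ n : ℕ in atTop, |(m n : ℝ) - (n : ℝ) ^ α| < 1) (k : ℕ) :
    Tendsto (fun n : ℕ => Real.log n ^ k * (m n / n)) atTop (𝓝 0) := by
  have h := (tendsto_log_pow_mul_rpow_neg k (sub_pos.2 hα1)).const_mul 2
  rw [mul_zero] at h
  refine squeeze_zero' (Eventually.of_forall fun n => ?_) ?_ h
  · have := Real.log_natCast_nonneg n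
    positivity
  · filter_upwards [eventually_rpow_bounds hα hm, eventually_gt_atTop 0] with n hn hn0
    have hn' : (0 : ℝ) < n := by exact_mod_cast hn0
    have hlog := Real.log_natCast_nonneg n
    rw [neg_sub, Real.rpow_sub hn', Real.rpow_one]
    calc Real.log n ^ k * (m n / n) ≤ Real.log n ^ k * (2 * (n : ℝ) ^ α / n) := by
          gcongr
          exact hn.2
      _ = _ := by ring

/-! ### Below the threshold -/

theorem probRIG_not (n m : ℕ) (p : I) (A : SimpleGraph (Fin n) → Prop) :
    probRIG n m p (fun G => ¬ A G) = 1 - probRIG n m p A := by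
  have h := probReal_add_probReal_compl (μ := featureLaw n m p)
    (s := {W | A (intersectionGraph W)}) (measurableSet_featureEvent _)
  rw [probRIG, probRIG, ← h]
  simp [Set.compl_ofPred]

/-- The second moment bound in the limit: `hmx` says that the expected number of isolated vertices,
about `n * exp (-(m * x))`, tends to infinity. -/
theorem tendsto_probRIG_not_connected {m : ℕ → ℕ} {p : ℕ → I} {x : ℕ → ℝ}
    (hm : Tendsto m atTop atTop)
    (hpx : ∀ᶠ n : ℕ in atTop, (p n : ℝ) ≤ x n ∨ (n : ℝ) * (p n : ℝ) ^ 2 ≤ x n)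
    (hmx : Tendsto (fun n : ℕ => m n * x n - Real.log n) atTop atBot)
    (hmx2 : Tendsto (fun n => m n * x n ^ 2) atTop (𝓝 0))
    (hmp2 : Tendsto (fun n => m n * (p n : ℝ) ^ 2) atTop (𝓝 0)) :
    Tendsto (fun n : ℕ => probRIG n (m n) (p n) (fun G => ¬ G.Connected)) atTop (𝓝 1) := by
  -- `m * y ^ 2 → 0` and `m ≥ 1` bring `y` below `1 / 2`
  have hle_half : ∀ {M : ℕ} {y : ℝ}, 1 ≤ M → M * y ^ 2 ≤ 1 / 4 → y ≤ 1 / 2 := by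
    intro M y hM h
    have hM' : (1 : ℝ) ≤ M := by exact_mod_cast hM
    nlinarith [sq_nonneg y]
  have h0 : Tendsto (fun n : ℕ => probRIG n (m n) (p n) (fun G => G.Connected)) atTop (𝓝 0) := by
    have h1 : Tendsto (fun n : ℕ => Real.exp ((m n * x n - Real.log n) + 2 * (m n * x n ^ 2)))
        atTop (𝓝 0) :=
      Real.tendsto_exp_atBot.comp (hmx.atBot_add (hmx2.const_mul 2))
    have h2 : Tendsto (fun n : ℕ => Real.exp (8 * (m n * (p n : ℝ) ^ 2)) - 1) atTop (𝓝 0) := by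
      have := ((Real.continuous_exp.tendsto _).comp (hmp2.const_mul 8)).sub_const 1
      simpa using this
    have h3 := h1.add h2
    rw [add_zero] at h3
    refine squeeze_zero' (Eventually.of_forall fun n => measureReal_nonneg) ?_ h3
    filter_upwards [hpx, hmx2.eventually (ge_mem_nhds (by norm_num : (0 : ℝ) < 1 / 4)),
      hmp2.eventually (ge_mem_nhds (by norm_num : (0 : ℝ) < 1 / 4)), eventually_ge_atTop 2,
      hm.eventually (eventually_ge_atTop 1)] with n h1 h2 h3 h4 h5
    have hn : (0 : ℝ) < n := by exact_mod_cast (by omega : 0 < n)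
    refine (probRIG_connected_le h4 (m n) (p n) (hle_half h5 h3) (hle_half h5 h2) h1).trans
      (le_of_eq ?_)
    have e : (m n * x n - Real.log n) + 2 * (m n * x n ^ 2) =
        (m n * x n + 2 * (m n * x n ^ 2)) - Real.log n := by ring
    rw [e, Real.exp_sub, Real.exp_log hn]
  simp_rw [probRIG_not]
  simpa using h0.const_sub 1

theorem tendsto_probRIG_not_connected_of_tendsto_atBot {α : ℝ} (hα : 0 < α) {m : ℕ → ℕ}
    (hm : ∀ᶠ n : ℕ in atTop, |(m n : ℝ) - (n : ℝ) ^ α| < 1) {ω : ℕ → ℝ} {p : ℕ → I}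
    (hp : ∀ᶠ n : ℕ in atTop, (p n : ℝ) = thresholdP α n (m n) (ω n))
    (hω : Tendsto ω atTop atBot) :
    Tendsto (fun n : ℕ => probRIG n (m n) (p n) (fun G => ¬ G.Connected)) atTop (𝓝 1) := by
  have hm' := tendsto_atTop_of_abs_sub_rpow_lt hα hm
  have hω0 := hω.eventually (eventually_le_atBot 0)
  have hm1 := hm'.eventually (eventually_ge_atTop 1)
  rcases le_or_gt α 1 with h1 | h1
  · have hmp : ∀ᶠ n : ℕ in atTop, m n * (p n : ℝ) = Real.log n + ω n := by
      filter_upwards [hp, hm1] with n h2 h3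
      have : (0 : ℝ) < m n := by exact_mod_cast h3
      rw [h2, thresholdP, if_pos h1]
      field_simp
    have hsq : Tendsto (fun n => m n * (p n : ℝ) ^ 2) atTop (𝓝 0) := by
      refine squeeze_zero' (Eventually.of_forall fun n => by positivity) ?_
        (tendsto_log_pow_div hα hm 2)
      filter_upwards [hmp, hm1, hω0] with n h2 h3 h4
      have h5 : (0 : ℝ) < m n := by exact_mod_cast h3
      have h6 : 0 ≤ m n * (p n : ℝ) := mul_nonneg h5.le (p n).2.1
      rw [le_div_iff₀ h5]
      calc m n * (p n : ℝ) ^ 2 * m n = (m n * (p n : ℝ)) ^ 2 := by ring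
        _ ≤ _ := pow_le_pow_left₀ h6 (by linarith) 2
    refine tendsto_probRIG_not_connected (x := fun n => (p n : ℝ)) hm'
      (Eventually.of_forall fun n => Or.inl le_rfl) ?_ hsq hsq
    refine hω.congr' ?_
    filter_upwards [hmp] with n h2
    rw [h2]
    ring
  · have hmp : ∀ᶠ n : ℕ in atTop,
        m n * ((n : ℝ) * (p n : ℝ) ^ 2) = max (Real.log n + ω n) 0 := by
      filter_upwards [hp, hm1, eventually_ge_atTop 1] with n h2 h3 h4
      have h5 : (0 : ℝ) < m n := by exact_mod_cast h3
      have h6 : (0 : ℝ) < n := by exact_mod_cast h4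
      rw [h2, thresholdP, if_neg (not_le.2 h1), Real.sq_sqrt', ← mul_assoc,
        mul_max_of_nonneg _ _ (by positivity), mul_zero]
      congr 1
      field_simp
    have hmp_le : ∀ᶠ n : ℕ in atTop, m n * ((n : ℝ) * (p n : ℝ) ^ 2) ≤ Real.log n := by
      filter_upwards [hmp, hω0] with n h2 h3
      rw [h2]
      exact max_le (by linarith) (Real.log_natCast_nonneg n)
    refine tendsto_probRIG_not_connected (x := fun n => (n : ℝ) * (p n : ℝ) ^ 2) hm'
      (Eventually.of_forall fun n => Or.inr le_rfl) ?_ ?_ ?_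
    -- for `ω < -log n` the square root is that of a negative number, and `p = 0`
    · have hmax : Tendsto (fun n : ℕ => max (ω n) (-Real.log n)) atTop atBot := by
        rw [tendsto_atBot]
        intro b
        filter_upwards [hω.eventually (eventually_le_atBot b),
          tendsto_log_natCast.eventually (eventually_ge_atTop (-b))] with n h2 h3
        exact max_le h2 (by linarith)
      refine hmax.congr' ?_
      filter_upwards [hmp] with n h2
      rw [h2, ← max_sub_sub_right, add_sub_cancel_left, zero_sub]
    · refine squeeze_zero' (Eventually.of_forall fun n => by positivity) ?_
        (tendsto_log_pow_div hα hm 2)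
      filter_upwards [hmp_le, hm1] with n h2 h3
      have h5 : (0 : ℝ) < m n := by exact_mod_cast h3
      rw [le_div_iff₀ h5]
      calc m n * ((n : ℝ) * (p n : ℝ) ^ 2) ^ 2 * m n =
            (m n * ((n : ℝ) * (p n : ℝ) ^ 2)) ^ 2 := by ring
        _ ≤ _ := pow_le_pow_left₀ (by positivity) h2 2
    · have hlim := tendsto_log_pow_mul_rpow_neg 1 one_pos
      refine squeeze_zero' (Eventually.of_forall fun n => by positivity) ?_ hlim
      filter_upwards [hmp_le, eventually_ge_atTop 1] with n h2 h4
      have h6 : (0 : ℝ) < n := by exact_mod_cast h4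
      rw [Real.rpow_neg_one, pow_one, ← div_eq_mul_inv, le_div_iff₀ h6]
      linarith

/-! ### Above the threshold -/

theorem tendsto_probRIG_connected {m : ℕ → ℕ} {p : ℕ → I} {δ : ℕ → ℝ}
    (hδ : Tendsto δ atTop (𝓝 0))
    (h : ∀ᶠ n : ℕ in atTop, 1 - δ n ≤ probRIG n (m n) (p n) (fun G => G.Connected)) :
    Tendsto (fun n : ℕ => probRIG n (m n) (p n) (fun G => G.Connected)) atTop (𝓝 1) := by
  have h1 : Tendsto (fun n => 1 - δ n) atTop (𝓝 1) := by simpa using hδ.const_sub 1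
  exact tendsto_of_tendsto_of_tendsto_of_le_of_le' h1 tendsto_const_nhds h
    (Eventually.of_forall fun n => measureReal_le_one)

theorem tendsto_probRIG_connected_of_tendsto_cutSum {m : ℕ → ℕ} {p : ℕ → I} {q : ℕ → ℝ}
    (hq0 : ∀ᶠ n in atTop, 0 ≤ q n) (hqp : ∀ᶠ n in atTop, q n ≤ p n)
    (hq : Tendsto (fun n => cutSum n (m n) (q n)) atTop (𝓝 0)) :
    Tendsto (fun n : ℕ => probRIG n (m n) (p n) (fun G => G.Connected)) atTop (𝓝 1) := by
  refine tendsto_probRIG_connected hq ?_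
  filter_upwards [hq0, hqp, eventually_gt_atTop 0] with n h1 h2 h3
  have := one_sub_cutSum_le_probRIG_connected h3 (m n) (p n)
  have := cutSum_anti (n := n) (m := m n) h1 h2 (p n).2.2
  linarith

/-- Few features: the features are connected to each other by a wide margin, and the threshold is
that for a vertex without features. -/
theorem tendsto_probRIG_connected_of_lt_one {α : ℝ} (hα : 0 < α) (hα1 : α < 1) {m : ℕ → ℕ}
    (hm : ∀ᶠ n : ℕ in atTop, |(m n : ℝ) - (n : ℝ) ^ α| < 1) {ω : ℕ → ℝ} {p : ℕ → I}
    (hp : ∀ᶠ n : ℕ in atTop, (p n : ℝ) = (Real.log n + ω n) / m n)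
    (hω : Tendsto ω atTop atTop) :
    Tendsto (fun n : ℕ => probRIG n (m n) (p n) (fun G => G.Connected)) atTop (𝓝 1) := by
  have hm' := tendsto_atTop_of_abs_sub_rpow_lt hα hm
  have hm1 := hm'.eventually (eventually_ge_atTop 1)
  have hω0 := hω.eventually (eventually_ge_atTop 0)
  have hl3 := tendsto_log_natCast.eventually (eventually_ge_atTop 3)
  have hmn : ∀ᶠ n : ℕ in atTop, (m n : ℝ) ≤ n := by
    have h := tendsto_log_pow_mul_div_of_lt_one hα hα1 hm 0
    filter_upwards [h.eventually (ge_mem_nhds one_pos), eventually_gt_atTop 0] with n h1 h2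
    have h3 : (0 : ℝ) < n := by exact_mod_cast h2
    rw [pow_zero, one_mul, div_le_one h3] at h1
    exact h1
  -- for the graph on the `m` features, this lies above the threshold and below `p`
  set q : ℕ → ℝ := fun n => Real.sqrt (3 * Real.log n / (n * m n)) with hq
  have hq0 : ∀ n, 0 ≤ q n := fun n => Real.sqrt_nonneg _
  have hqsq : ∀ᶠ n : ℕ in atTop, (m n : ℝ) * n * q n ^ 2 = 3 * Real.log n := by
    filter_upwards [hm1, eventually_gt_atTop 0] with n h1 h2
    have h3 : (0 : ℝ) < n := by exact_mod_cast h2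
    have h4 : (0 : ℝ) < m n := by exact_mod_cast h1
    have := Real.log_natCast_nonneg n
    rw [hq]
    simp only
    rw [Real.sq_sqrt (by positivity)]
    field_simp
  have hqp : ∀ᶠ n in atTop, q n ≤ p n := by
    filter_upwards [hp, hm1, eventually_gt_atTop 0, hmn, hω0, hl3] with n h1 h2 h3 h4 h5 h6
    have h7 : (0 : ℝ) < n := by exact_mod_cast h3
    have h8 : (0 : ℝ) < m n := by exact_mod_cast h2
    refine Real.sqrt_le_iff.2 ⟨(p n).2.1, ?_⟩
    rw [h1, div_pow, div_le_div_iff₀ (by positivity) (by positivity)]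
    calc 3 * Real.log n * (m n : ℝ) ^ 2 = (m n * m n) * (3 * Real.log n) := by ring
      _ ≤ (n * m n) * (Real.log n * Real.log n) := by gcongr
      _ = Real.log n ^ 2 * (n * m n) := by ring
      _ ≤ _ := by gcongr; linarith
  have hsmall : ∀ᶠ n : ℕ in atTop, (m n : ℝ) * n * q n ^ 2 * (m n * q n) ≤ 1 := by
    have h := (tendsto_log_pow_mul_div_of_lt_one hα hα1 hm 3).const_mul 27
    rw [mul_zero] at h
    filter_upwards [h.eventually (ge_mem_nhds one_pos), hqsq, eventually_gt_atTop 0]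
      with n h1 h2 h3
    have h7 : (0 : ℝ) < n := by exact_mod_cast h3
    rw [h2]
    refine le_of_abs_le ((sq_le_one_iff_abs_le_one _).1 ?_)
    have : (3 * Real.log n * (m n * q n)) ^ 2 =
        9 * Real.log n ^ 2 * (m n / n) * (m n * n * q n ^ 2) := by field_simp; ring
    rw [this, h2]
    linarith
  have hcut : Tendsto (fun n => cutSum (m n) n (q n)) atTop (𝓝 0) := by
    refine tendsto_cutSum_of_sparse (N := m) (M := fun n => n) hm'
      (Eventually.of_forall hq0) ?_ ?_ ?_ hsmall
    · filter_upwards [hmn] with n h1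
      have : (0 : ℝ) ≤ n := Nat.cast_nonneg n
      linarith
    · filter_upwards [hsmall, hqsq, hl3] with n h1 h2 h3
      rw [h2] at h1
      have : 0 ≤ m n * q n := mul_nonneg (Nat.cast_nonneg _) (hq0 n)
      nlinarith
    · refine tendsto_atTop_mono' _ ?_ tendsto_log_natCast
      filter_upwards [hqsq, hmn, hm1] with n h1 h2 h3
      have h4 : (0 : ℝ) < m n := by exact_mod_cast h3
      have h5 := Real.log_le_log h4 h2
      have := Real.log_natCast_nonneg n
      rw [h1]
      linarith
  have hδ : Tendsto (fun n => cutSum (m n) n (q n) + Real.exp (-ω n)) atTop (𝓝 0) := by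
    simpa using hcut.add (Real.tendsto_exp_neg_atTop_nhds_zero.comp hω)
  refine tendsto_probRIG_connected hδ ?_
  filter_upwards [hqp, eventually_gt_atTop 0, hp, hm1] with n h2 h3 h4 h5
  have h6 := one_sub_dual_cutSum_le_probRIG_connected h3 (m n) (p n)
  have h7 := cutSum_anti (n := m n) (m := n) (hq0 n) h2 (p n).2.2
  have h8 : n * (1 - p n : ℝ) ^ m n ≤ Real.exp (-ω n) := by
    have hn : (0 : ℝ) < n := by exact_mod_cast h3
    have hmpos : (0 : ℝ) < m n := by exact_mod_cast h5
    calc n * (1 - p n : ℝ) ^ m n ≤ n * Real.exp (-(m n * p n)) := by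
          gcongr
          exact one_sub_pow_le_exp_neg_mul (p n).2.2 _
      _ = Real.exp (Real.log n) * Real.exp (-(Real.log n + ω n)) := by
          rw [Real.exp_log hn, h4]
          congr 3
          field_simp
      _ = _ := by rw [← Real.exp_add]; ring_nf
  linarith

theorem tendsto_min_log_atTop {ω : ℕ → ℝ} (hω : Tendsto ω atTop atTop) :
    Tendsto (fun n : ℕ => min (ω n) (Real.log n)) atTop atTop := by
  rw [tendsto_atTop]
  intro b
  filter_upwards [hω.eventually (eventually_ge_atTop b),
    tendsto_log_natCast.eventually (eventually_ge_atTop b)] with n h1 h2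
  exact le_min h1 h2

/-- As many features as vertices: `n * q` tends to infinity like `log n`, so that almost every
feature of a vertex is shared, and `m * q` governs the isolated vertices. -/
theorem tendsto_probRIG_connected_of_eq_card {m : ℕ → ℕ} (hm : ∀ᶠ n : ℕ in atTop, m n = n)
    {ω : ℕ → ℝ} {p : ℕ → I}
    (hp : ∀ᶠ n : ℕ in atTop, (p n : ℝ) = (Real.log n + ω n) / m n)
    (hω : Tendsto ω atTop atTop) :
    Tendsto (fun n : ℕ => probRIG n (m n) (p n) (fun G => G.Connected)) atTop (𝓝 1) := by
  -- bounding `ω` by `log n` lowers `p`, and the cut sum is antitone in `p`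
  set s : ℕ → ℝ := fun n => min (ω n) (Real.log n) with hs
  have hst := tendsto_min_log_atTop hω
  have hs0 := hst.eventually (eventually_ge_atTop 0)
  set q : ℕ → ℝ := fun n => (Real.log n + s n) / n with hq
  have hq0 : ∀ᶠ n in atTop, 0 ≤ q n := by
    filter_upwards [hs0] with n h1
    exact div_nonneg (add_nonneg (Real.log_natCast_nonneg n) h1) (Nat.cast_nonneg n)
  have hqp : ∀ᶠ n in atTop, q n ≤ p n := by
    filter_upwards [hp, hm] with n h1 h2
    rw [h1, h2]
    simp only [hq]
    gcongr
    exact min_le_left _ _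
  have hnq : ∀ᶠ n : ℕ in atTop, n * q n = Real.log n + s n := by
    filter_upwards [eventually_gt_atTop 0] with n h1
    have h2 : (0 : ℝ) < n := by exact_mod_cast h1
    simp only [hq]
    field_simp
  have hq1 : ∀ᶠ n in atTop, q n ≤ 1 := hqp.mono fun n h => h.trans (p n).2.2
  refine tendsto_probRIG_connected_of_tendsto_cutSum hq0 hqp
    (tendsto_cutSum (N := fun n => n) tendsto_id hq0 hq1 ?_ ?_ ?_)
  · filter_upwards [hm] with n h1
    rw [h1]
    have : (0 : ℝ) ≤ n := Nat.cast_nonneg n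
    linarith
  · filter_upwards [hnq] with n h1
    have h2 : s n ≤ Real.log n := min_le_right _ _
    have := Real.log_natCast_nonneg n
    rw [h1]
    linarith
  · refine tendsto_atTop_mono' _ ?_ (tendsto_atTop_add_const_right _ (-1) hst)
    filter_upwards [hm, hnq, hs0, hq1] with n h1 h2 h3 h4
    have h5 := one_sub_pow_le_exp_neg_mul h4 n
    rw [h2] at h5
    rw [h1, h2]
    set y := Real.log n + s n with hy
    have hy0 : 0 ≤ y := add_nonneg (Real.log_natCast_nonneg n) h3
    have h6 : y * Real.exp (-y) ≤ 1 := by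
      rw [Real.exp_neg, ← div_eq_mul_inv, div_le_one (Real.exp_pos y)]
      linarith [Real.add_one_le_exp y]
    have h7 : y * (1 - q n) ^ n ≤ y * Real.exp (-y) := by gcongr
    change s n + -1 ≤ _
    linarith

/-- Many features: `n * q → 0`, and the threshold is the one for `n * m * p ^ 2`, the expected
number of pairs of a neighbour and a feature shared with it. -/
theorem tendsto_probRIG_connected_of_one_lt {α : ℝ} (hα : 1 < α) {m : ℕ → ℕ}
    (hm : ∀ᶠ n : ℕ in atTop, |(m n : ℝ) - (n : ℝ) ^ α| < 1) {ω : ℕ → ℝ} {p : ℕ → I}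
    (hp : ∀ᶠ n : ℕ in atTop, (p n : ℝ) = Real.sqrt ((Real.log n + ω n) / (n * m n)))
    (hω : Tendsto ω atTop atTop) :
    Tendsto (fun n : ℕ => probRIG n (m n) (p n) (fun G => G.Connected)) atTop (𝓝 1) := by
  have hm' := tendsto_atTop_of_abs_sub_rpow_lt (by linarith) hm
  have hm1 := hm'.eventually (eventually_ge_atTop 1)
  have hl1 := tendsto_log_natCast.eventually (eventually_ge_atTop 1)
  -- bounding `ω` by `log n` lowers `p`, and the cut sum is antitone in `p`
  set s : ℕ → ℝ := fun n => min (ω n) (Real.log n) with hs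
  have hst := tendsto_min_log_atTop hω
  have hs0 := hst.eventually (eventually_ge_atTop 0)
  set q : ℕ → ℝ := fun n => Real.sqrt ((Real.log n + s n) / (n * m n)) with hq
  have hq0 : ∀ n, 0 ≤ q n := fun n => Real.sqrt_nonneg _
  have hqp : ∀ᶠ n in atTop, q n ≤ p n := by
    filter_upwards [hp] with n h1
    rw [h1]
    refine Real.sqrt_le_sqrt ?_
    gcongr
    exact min_le_left _ _
  have hqsq : ∀ᶠ n : ℕ in atTop, (n : ℝ) * m n * q n ^ 2 = Real.log n + s n := by
    filter_upwards [hm1, eventually_gt_atTop 0, hs0] with n h1 h2 h3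
    have h4 : (0 : ℝ) < n := by exact_mod_cast h2
    have h5 : (0 : ℝ) < m n := by exact_mod_cast h1
    have h6 : 0 ≤ Real.log n + s n := add_nonneg (Real.log_natCast_nonneg n) h3
    simp only [hq]
    rw [Real.sq_sqrt (by positivity)]
    field_simp
  have hsmall : ∀ᶠ n : ℕ in atTop, (n : ℝ) * m n * q n ^ 2 * (n * q n) ≤ 1 := by
    have h := (tendsto_log_pow_mul_div_of_one_lt hα hm 3).const_mul 8
    rw [mul_zero] at h
    filter_upwards [h.eventually (ge_mem_nhds one_pos), hqsq, hm1, hs0]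
      with n h1 h2 h3 h4
    have h5 : (0 : ℝ) < m n := by exact_mod_cast h3
    have h6 : 0 ≤ Real.log n + s n := add_nonneg (Real.log_natCast_nonneg n) h4
    have h7 : s n ≤ Real.log n := min_le_right _ _
    rw [h2]
    refine le_of_abs_le ((sq_le_one_iff_abs_le_one _).1 ?_)
    have : ((Real.log n + s n) * (n * q n)) ^ 2 =
        (Real.log n + s n) ^ 2 * (n / m n) * (n * m n * q n ^ 2) := by field_simp
    rw [this, h2]
    calc (Real.log n + s n) ^ 2 * (n / m n) * (Real.log n + s n) =
          (Real.log n + s n) ^ 3 * (n / m n) := by ring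
      _ ≤ (2 * Real.log n) ^ 3 * (n / m n) := by gcongr; linarith
      _ = 8 * (Real.log n ^ 3 * (n / m n)) := by ring
      _ ≤ 1 := h1
  refine tendsto_probRIG_connected_of_tendsto_cutSum (Eventually.of_forall hq0) hqp
    (tendsto_cutSum_of_sparse (N := fun n => n) tendsto_id (Eventually.of_forall hq0)
      ?_ ?_ ?_ hsmall)
  · have h := tendsto_log_pow_mul_div_of_one_lt hα hm 0
    filter_upwards [h.eventually (ge_mem_nhds one_pos), hm1] with n h1 h2
    have h3 : (0 : ℝ) < m n := by exact_mod_cast h2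
    rw [pow_zero, one_mul, div_le_one h3] at h1
    linarith
  · filter_upwards [hsmall, hqsq, hl1, hs0] with n h1 h2 h3 h4
    rw [h2] at h1
    have : 0 ≤ n * q n := mul_nonneg (Nat.cast_nonneg _) (hq0 n)
    nlinarith
  · refine hst.congr' ?_
    filter_upwards [hqsq] with n h1
    rw [h1]
    ring

theorem mainTheorem4 (α : ℝ) (hα : 0 < α)
    (m : ℕ → ℕ) (hm : ∀ᶠ n : ℕ in atTop, |(m n : ℝ) - (n : ℝ) ^ α| < 1)
    (ω : ℕ → ℝ) (p : ℕ → unitInterval)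
    (hp : ∀ᶠ n : ℕ in atTop, (p n : ℝ) = thresholdP α n (m n) (ω n)) :
    (Tendsto ω atTop atBot →
      Tendsto (fun n : ℕ => probRIG n (m n) (p n) (fun G => ¬ G.Connected)) atTop (𝓝 1)) ∧
    (Tendsto ω atTop atTop →
      Tendsto (fun n : ℕ => probRIG n (m n) (p n) (fun G => G.Connected)) atTop (𝓝 1)) := by
  refine ⟨tendsto_probRIG_not_connected_of_tendsto_atBot hα hm hp, fun hω => ?_⟩
  rcases lt_trichotomy α 1 with h | rfl | h
  · refine tendsto_probRIG_connected_of_lt_one hα h hm ?_ hω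
    filter_upwards [hp] with n hn
    rw [hn, thresholdP, if_pos h.le]
  · refine tendsto_probRIG_connected_of_eq_card ?_ ?_ hω
    · -- distinct natural numbers are at distance at least `1`
      filter_upwards [hm] with n hn
      rw [Real.rpow_one] at hn
      have h1 : |(m n : ℤ) - n| < 1 := by exact_mod_cast hn
      have h2 := Int.abs_lt_one_iff.1 h1
      omega
    · filter_upwards [hp] with n hn
      rw [hn, thresholdP, if_pos le_rfl]
  · refine tendsto_probRIG_connected_of_one_lt h hm ?_ hω
    filter_upwards [hp] with n hn
    rw [hn, thresholdP, if_neg (not_le.2 h)]
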